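/- Let $\mathbb H$ be the upper half-plane with its hyperbolic metric, on which $G=\mathrm{PSL}_2(\mathbb R)$ acts by Möbius transformations, and let $\sigma(z)=-\overline z$. Let $\Gamma$ be a discrete, torsion-free subgroup of $G$ such that the quotient $\mathbb X=\Gamma\backslash\mathbb H$ is compact and $\sigma\Gamma\sigma=\Gamma$. Then $\sigma^*(\Gamma z)=\Gamma\sigma(z)$ is a well-defined involution of $\mathbb X$, and every connected component of its fixed point set $\mathrm{Fix}(\sigma^*,\mathbb X)=\{x\in\mathbb X:\sigma^*(x)=x\}$ is a closed geodesic in $\mathbb X$; that is, it is the image of a unit speed geodesic $\mathbb R\to\mathbb X$ (the projection to $\mathbb X$ of a complete unit speed geodesic of $\mathbb H$) which is periodic with some period $L>0$. -/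

import Mathlib

open scoped MatrixGroups ComplexConjugate UpperHalfPlane

noncomputable section

namespace HypSurface

theorem smul_eq_of_mem_center (g : SL(2, ℝ)) (hg : g ∈ Subgroup.center SL(2, ℝ)) (z : ℍ) :
    g • z = z := by
  obtain ⟨r, hr, h⟩ := (Matrix.SpecialLinearGroup.mem_center_iff).1 hg
  have hr0 : r ≠ 0 := by
    rintro rfl
    simp at hr
  have h2 : ∀ i j, g i j = Matrix.scalar (Fin 2) r i j := fun i j => by rw [h]
  ext1
  rw [UpperHalfPlane.coe_specialLinearGroup_apply]
  simp [h2, hr0]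

/-- The action of `PSL(2, ℝ) = SL(2, ℝ) / {±1}` on the upper half-plane by Möbius
transformations, induced by the one of `SL(2, ℝ)`. -/
instance pslAction : MulAction PSL(2, ℝ) ℍ where
  smul g z := Quotient.liftOn' g (fun a : SL(2, ℝ) => a • z) (by
    intro a b hab
    have h := smul_eq_of_mem_center _ (QuotientGroup.leftRel_apply.1 hab) z
    change a • z = b • z
    rw [mul_smul, inv_smul_eq_iff] at h
    exact h.symm)
  one_smul z := one_smul SL(2, ℝ) z
  mul_smul g h z := by
    induction g using QuotientGroup.induction_on
    induction h using QuotientGroup.induction_on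
    exact mul_smul (α := SL(2, ℝ)) _ _ z

/-- The orientation reversing isometry `σ(z) = -z̄` of the upper half-plane. -/
def sigma (z : ℍ) : ℍ := ⟨-conj (z : ℂ), by simpa using z.im_pos⟩

/-- The map `(a, b; c, d) ↦ (a, -b; -c, d)` on `SL(2, ℝ)`. -/
def hatFun (g : SL(2, ℝ)) : SL(2, ℝ) :=
  ⟨!![g 0 0, -g 0 1; -g 1 0, g 1 1], by
    have h := g.det_coe
    rw [Matrix.det_fin_two] at h
    simp [Matrix.det_fin_two, h]⟩

theorem hatFun_coe (g : SL(2, ℝ)) :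
    (hatFun g : Matrix (Fin 2) (Fin 2) ℝ) = !![g 0 0, -g 0 1; -g 1 0, g 1 1] := rfl

/-- The automorphism `(a, b; c, d) ↦ (a, -b; -c, d)` of `SL(2, ℝ)`. -/
def hatSL : SL(2, ℝ) →* SL(2, ℝ) where
  toFun := hatFun
  map_one' := by
    ext i j
    fin_cases i <;> fin_cases j <;> simp [hatFun_coe]
  map_mul' g h := by
    ext i j
    fin_cases i <;> fin_cases j <;>
      simp [hatFun_coe, Matrix.mul_apply, Fin.sum_univ_two, add_comm]

theorem hatSL_coe (g : SL(2, ℝ)) :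
    (hatSL g : Matrix (Fin 2) (Fin 2) ℝ) = !![g 0 0, -g 0 1; -g 1 0, g 1 1] := rfl

theorem hatSL_mem_center (g : SL(2, ℝ)) (hg : g ∈ Subgroup.center SL(2, ℝ)) :
    hatSL g ∈ Subgroup.center SL(2, ℝ) := by
  obtain ⟨r, hr, h⟩ := (Matrix.SpecialLinearGroup.mem_center_iff).1 hg
  refine (Matrix.SpecialLinearGroup.mem_center_iff).2 ⟨r, hr, ?_⟩
  have h2 : ∀ i j, g i j = Matrix.scalar (Fin 2) r i j := fun i j => by rw [h]
  ext i j
  fin_cases i <;> fin_cases j <;> simp [hatSL_coe, h2]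

/-- The automorphism `α ↦ α̂ = σ α σ` of `PSL(2, ℝ)`, given on matrices by
`(a, b; c, d) ↦ (a, -b; -c, d)`; see `hat_smul`. -/
def hat : PSL(2, ℝ) →* PSL(2, ℝ) :=
  QuotientGroup.map _ _ hatSL hatSL_mem_center

/-- `hat g` is the transformation `σ g σ` of the upper half-plane. -/
theorem hat_smul (g : PSL(2, ℝ)) (z : ℍ) : hat g • z = sigma (g • sigma z) := by
  induction g using QuotientGroup.induction_on with
  | H a =>
    change hatSL a • z = sigma (a • sigma z)
    ext1
    simp only [sigma, UpperHalfPlane.coe_specialLinearGroup_apply, hatSL_coe]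
    simp
    rw [← neg_div]
    congr 1; ring

theorem sigma_sigma (z : ℍ) : sigma (sigma z) = z := by
  ext1
  simp [sigma]

/-- The surface `X = Γ \ ℍ`, a topological space with the quotient topology. -/
abbrev Surface (Γ : Subgroup PSL(2, ℝ)) : Type := MulAction.orbitRel.Quotient Γ ℍ

/-- The projection `z ↦ Γ z` from `ℍ` to `Γ \ ℍ`. -/
def proj (Γ : Subgroup PSL(2, ℝ)) (z : ℍ) : Surface Γ := Quotient.mk _ z

/-- The involution `σ*(Γ z) = Γ σ(z)` of `Γ \ ℍ`, where `σ Γ σ = Γ`. -/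
def sigmaStar (Γ : Subgroup PSL(2, ℝ)) (hΓ : Γ.map hat = Γ) : Surface Γ → Surface Γ :=
  Quotient.map sigma (by
    rintro z w ⟨g, rfl⟩
    have hg : hat g ∈ Γ := by
      have h := Subgroup.mem_map_of_mem hat g.2
      rwa [hΓ] at h
    refine ⟨⟨hat g, hg⟩, ?_⟩
    change hat (g : PSL(2, ℝ)) • sigma w = sigma ((g : PSL(2, ℝ)) • w)
    rw [hat_smul, sigma_sigma])

/-- A subset `C` of `Γ \ ℍ` is a closed geodesic if it is the image of a periodic geodesic of
positive period. The unit speed geodesics `ℝ → Γ \ ℍ` are the projections of the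
complete unit speed geodesics of `ℍ`, that is, of the isometric embeddings `c : ℝ → ℍ` for the
hyperbolic distance. -/
def IsClosedGeodesic (Γ : Subgroup PSL(2, ℝ)) (C : Set (Surface Γ)) : Prop :=
  ∃ (c : ℝ → ℍ) (L : ℝ), Isometry c ∧ 0 < L ∧
    Function.Periodic (fun t => proj Γ (c t)) L ∧ C = Set.range (fun t => proj Γ (c t))

end HypSurface

end

noncomputable section

namespace HypSurface

/-! The point `Γz` is fixed exactly when `g • z = σ z` for some `g ∈ Γ`, so the fixed set is the
projection of the sets `axis g`, each empty or a complete geodesic (`axis_eq_range`).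
Torsion-freeness makes the action free, hence axes of distinct elements are disjoint; discreteness
makes them locally finite. `Γ` permutes them through `g ↦ hat d * g * d⁻¹`, so each component is the
image of one axis (`connectedComponentIn_fixedPoints`). By cocompactness and pigeonhole a nontrivial
element preserves that axis; acting without fixed points, it translates, which gives the period
(`exists_translation_along_axis`). -/

instance : IsIsometricSMul PSL(2, ℝ) ℍ where
  isometry_smul g := by
    induction g using QuotientGroup.induction_on with
    | H a => exact isometry_smul ℍ a

theorem sigma_isometry : Isometry sigma := by
  refine Isometry.of_dist_eq fun z w => ?_
  have h : dist ((sigma z : ℍ) : ℂ) (sigma w : ℍ) = dist (z : ℂ) w := by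
    change dist (-conj (z : ℂ)) (-conj (w : ℂ)) = _
    rw [dist_neg_neg, Complex.dist_conj_conj]
  have h1 : ∀ u : ℍ, (sigma u).im = u.im := fun u => by
    change -(conj (u : ℂ)).im = u.im
    simp
  rw [UpperHalfPlane.dist_eq, UpperHalfPlane.dist_eq, h, h1, h1]

theorem hat_smul_sigma (g : PSL(2, ℝ)) (z : ℍ) : hat g • sigma z = sigma (g • z) := by
  rw [hat_smul, sigma_sigma]

/-- A discrete subgroup of `PSL(2, ℝ)` acts properly discontinuously. -/
theorem finite_returns (Γ : Subgroup PSL(2, ℝ)) [DiscreteTopology Γ] {K : Set ℍ}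
    (hK : IsCompact K) : {g : PSL(2, ℝ) | g ∈ Γ ∧ ∃ z ∈ K, g • z ∈ K}.Finite := by
  have hc : IsCompact {a : SL(2, ℝ) | ∃ z ∈ K, a • z ∈ K} := by
    have h := (ProperSMul.isProperMap_smul_pair (G := SL(2, ℝ)) (X := ℍ)).isCompact_preimage
      (hK.prod hK)
    convert h.image continuous_fst using 1
    ext a
    simp only [Set.mem_ofPred_eq, Set.mem_image, Set.mem_preimage, Set.mem_prod, Prod.exists,
      exists_and_right, exists_eq_right]
    exact exists_congr fun z => and_comm
  -- A closed centre makes the quotient Hausdorff, so the discrete subgroup `Γ` is closed in it.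
  have hclosed : IsClosed ((Subgroup.center SL(2, ℝ) : Subgroup SL(2, ℝ)) : Set SL(2, ℝ)) := by
    rw [Subgroup.coe_center, ← Set.centralizer_univ]
    exact Set.isClosed_centralizer _
  have hc' := hc.image (QuotientGroup.continuous_mk (N := Subgroup.center SL(2, ℝ)))
  have hΓ : IsClosed (Γ : Set PSL(2, ℝ)) := Subgroup.isClosed_of_discrete
  have hd : IsDiscrete (Γ : Set PSL(2, ℝ)) := isDiscrete_iff_discreteTopology.mpr ‹_›
  refine ((hc'.inter_right hΓ).finite (hd.mono Set.inter_subset_right)).subset ?_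
  rintro g ⟨hg, z, hz, hgz⟩
  refine ⟨?_, hg⟩
  induction g using QuotientGroup.induction_on with
  | H a => exact ⟨a, ⟨z, hz, hgz⟩, rfl⟩

/-- All powers of `g` fix `z`, and only finitely many elements of `Γ` do, so `g` has finite order.
-/
theorem eq_one_of_smul_eq (Γ : Subgroup PSL(2, ℝ)) [DiscreteTopology Γ]
    (htf : ∀ γ ∈ Γ, IsOfFinOrder γ → γ = 1) {g : PSL(2, ℝ)} (hg : g ∈ Γ) {z : ℍ}
    (h : g • z = z) : g = 1 := by
  refine htf g hg (finite_powers.1 ((finite_returns Γ (isCompact_singleton (x := z))).subset ?_))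
  rintro _ ⟨n, rfl⟩
  refine ⟨Γ.pow_mem hg n, z, rfl, ?_⟩
  have : g ^ n ∈ MulAction.stabilizer PSL(2, ℝ) z := Subgroup.pow_mem _ h n
  exact this

/-! ### Axes: equivariance, local finiteness, disjointness -/

/-- The fixed point set of the orientation reversing isometry `σ g`. -/
def axis (g : PSL(2, ℝ)) : Set ℍ := {z | g • z = sigma z}

theorem smul_mem_axis {g : PSL(2, ℝ)} {z : ℍ} (hz : z ∈ axis g) (d : PSL(2, ℝ)) :
    d • z ∈ axis (hat d * g * d⁻¹) := by
  have h : g • z = sigma z := hz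
  change (hat d * g * d⁻¹) • d • z = _
  rw [mul_smul, inv_smul_smul, mul_smul, h, hat_smul_sigma]

theorem isClosed_axis (g : PSL(2, ℝ)) : IsClosed (axis g) :=
  isClosed_eq (continuous_const_smul g) sigma_isometry.continuous

/-- If the axis of `g` meets `K`, then `g` sends a point of `K` into `σ K`, so it is a return of `K
∪ σ K`. -/
theorem finite_axes_meeting (Γ : Subgroup PSL(2, ℝ)) [DiscreteTopology Γ] {K : Set ℍ}
    (hK : IsCompact K) : {g : PSL(2, ℝ) | g ∈ Γ ∧ (axis g ∩ K).Nonempty}.Finite := by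
  refine (finite_returns Γ (hK.union (hK.image sigma_isometry.continuous))).subset ?_
  rintro g ⟨hg, z, hz, hzK⟩
  exact ⟨hg, z, Or.inl hzK, Or.inr ⟨z, hzK, (show g • z = sigma z from hz).symm⟩⟩

theorem isClosed_iUnion_axis (Γ : Subgroup PSL(2, ℝ)) [DiscreteTopology Γ]
    {A : Set PSL(2, ℝ)} (hA : A ⊆ Γ) : IsClosed (⋃ g : A, axis g) := by
  refine LocallyFinite.isClosed_iUnion (fun z => ?_) fun g => isClosed_axis g
  refine ⟨Metric.closedBall z 1, Metric.closedBall_mem_nhds z one_pos, ?_⟩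
  refine Set.Finite.of_finite_image (f := Subtype.val) ?_ Subtype.val_injective.injOn
  refine (finite_axes_meeting Γ (isCompact_closedBall z 1)).subset ?_
  rintro _ ⟨g, hg, rfl⟩
  exact ⟨hA g.2, hg⟩

theorem eq_of_mem_axis (Γ : Subgroup PSL(2, ℝ)) [DiscreteTopology Γ]
    (htf : ∀ γ ∈ Γ, IsOfFinOrder γ → γ = 1) {g h : PSL(2, ℝ)} (hg : g ∈ Γ) (hh : h ∈ Γ)
    {z : ℍ} (hzg : z ∈ axis g) (hzh : z ∈ axis h) : g = h := by
  have : (g⁻¹ * h) • z = z := by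
    rw [mul_smul, inv_smul_eq_iff]
    exact (show h • z = sigma z from hzh).trans (show g • z = sigma z from hzg).symm
  exact inv_mul_eq_one.1 (eq_one_of_smul_eq Γ htf (mul_mem (inv_mem hg) hh) this)

/-! ### Axes are geodesics -/

/-- The half-circle of radius `r` centered at `a`, parametrized by arc length. -/
def halfCircle (a r : ℝ) (hr : 0 < r) (t : ℝ) : ℍ :=
  ⟨⟨a + r * (Real.sinh t / Real.cosh t), r / Real.cosh t⟩, div_pos hr (Real.cosh_pos t)⟩

theorem isometry_halfCircle (a r : ℝ) (hr : 0 < r) : Isometry (halfCircle a r hr) := by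
  refine Isometry.of_dist_eq fun s t => ?_
  refine Real.cosh_strictMonoOn.injOn dist_nonneg dist_nonneg ?_
  have hs := (Real.cosh_pos s).ne'
  have ht := (Real.cosh_pos t).ne'
  rw [UpperHalfPlane.cosh_dist', Real.dist_eq, Real.cosh_abs, Real.cosh_sub]
  simp only [halfCircle, UpperHalfPlane.re, UpperHalfPlane.im]
  field_simp
  have hs2 := Real.cosh_sq s
  have ht2 := Real.cosh_sq t
  generalize Real.cosh s = x at *
  generalize Real.cosh t = y at *
  generalize Real.sinh s = u at *
  generalize Real.sinh t = v at *
  grind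

theorem mem_range_halfCircle {a r : ℝ} (hr : 0 < r) {z : ℍ}
    (hz : (z.re - a) ^ 2 + z.im ^ 2 = r ^ 2) : z ∈ Set.range (halfCircle a r hr) := by
  have hy := z.im_pos
  have hc : Real.cosh (Real.arsinh ((z.re - a) / z.im)) = r / z.im := by
    rw [Real.cosh_arsinh, show 1 + ((z.re - a) / z.im) ^ 2 = (r / z.im) ^ 2 by
      rw [div_pow r, ← hz]; field_simp; ring, Real.sqrt_sq (div_pos hr hy).le]
  refine ⟨Real.arsinh ((z.re - a) / z.im), ?_⟩
  ext1
  apply Complex.ext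
  · simp only [halfCircle, hc, Real.sinh_arsinh]
    field_simp
    simp
  · simp only [halfCircle, hc]
    field_simp
    simp

theorem halfCircle_eq {a r : ℝ} (hr : 0 < r) (t : ℝ) :
    ((halfCircle a r hr t).re - a) ^ 2 + (halfCircle a r hr t).im ^ 2 = r ^ 2 := by
  have h := Real.cosh_sq t
  have hc := (Real.cosh_pos t).ne'
  simp only [halfCircle, UpperHalfPlane.re, UpperHalfPlane.im]
  field_simp
  linear_combination -r ^ 2 * h

/-- The imaginary part of `az + b = -z̄(cz + d)` forces `a = d`; the real part is then the equation
of a circle or line. -/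
theorem mem_axis_mk_iff (a : SL(2, ℝ)) (z : ℍ) :
    z ∈ axis (a : PSL(2, ℝ)) ↔ a 0 0 = a 1 1 ∧
      a 1 0 * (z.re ^ 2 + z.im ^ 2) + 2 * a 0 0 * z.re + a 0 1 = 0 := by
  have hy := z.im_pos
  change a • z = sigma z ↔ _
  have hd : ((a 1 0 : ℝ) : ℂ) * z + (a 1 1 : ℝ) ≠ 0 := UpperHalfPlane.denom_ne_zero a z
  rw [UpperHalfPlane.ext_iff, UpperHalfPlane.coe_specialLinearGroup_apply]
  change _ = -conj (z : ℂ) ↔ _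
  simp only [Algebra.algebraMap_self, RingHom.id_apply]
  rw [div_eq_iff hd, Complex.ext_iff]
  simp
  constructor
  · rintro ⟨h1, h2⟩
    have h3 : a 0 0 = a 1 1 := by
      have : (a 0 0 - a 1 1) * z.im = 0 := by linarith
      rcases mul_eq_zero.1 this with h | h
      · linarith
      · exact absurd h hy.ne'
    refine ⟨h3, ?_⟩
    rw [← h3] at h1
    linarith
  · rintro ⟨h1, h2⟩
    rw [← h1]
    constructor <;> linarith

theorem axis_eq_range (g : PSL(2, ℝ)) (hg : (axis g).Nonempty) :
    ∃ c : ℝ → ℍ, Isometry c ∧ axis g = Set.range c := by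
  induction g using QuotientGroup.induction_on with
  | H a =>
    obtain ⟨w, hw⟩ := hg
    have had := ((mem_axis_mk_iff a w).1 hw).1
    have hdet := a.det_coe
    rw [Matrix.det_fin_two, ← had] at hdet
    have key : ∀ z, z ∈ axis (a : PSL(2, ℝ)) ↔
        a 1 0 * (z.re ^ 2 + z.im ^ 2) + 2 * a 0 0 * z.re + a 0 1 = 0 := fun z => by
      rw [mem_axis_mk_iff, and_iff_right had]
    by_cases hc : a 1 0 = 0
    · have ha : a 0 0 ≠ 0 := by
        intro h
        simp [h, hc] at hdet
      refine ⟨_, UpperHalfPlane.isometry_vertical_line (-a 0 1 / (2 * a 0 0)), ?_⟩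
      ext z
      rw [key, hc, zero_mul, zero_add]
      constructor
      · intro h
        refine ⟨Real.log z.im, ?_⟩
        ext1
        apply Complex.ext
        · change -a 0 1 / (2 * a 0 0) = z.re
          field_simp
          linarith
        · exact Real.exp_log z.im_pos
      · rintro ⟨t, rfl⟩
        change 2 * a 0 0 * (-a 0 1 / (2 * a 0 0)) + _ = 0
        field_simp
        ring
    -- Completing the square and using `a² - bc = 1` gives centre `-a/c` and squared radius `1/c²`.
    · have hr : 0 < 1 / |a 1 0| := by positivity
      refine ⟨_, isometry_halfCircle (-a 0 0 / a 1 0) _ hr, ?_⟩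
      have hiff : ∀ z : ℍ, z ∈ axis (a : PSL(2, ℝ)) ↔
          (z.re - -a 0 0 / a 1 0) ^ 2 + z.im ^ 2 = (1 / |a 1 0|) ^ 2 := fun z => by
        rw [key, div_pow, sq_abs]
        field_simp
        constructor
        · intro h
          linear_combination a 1 0 * h + hdet
        · intro h
          have : a 1 0 * (a 1 0 * (z.re ^ 2 + z.im ^ 2) + 2 * a 0 0 * z.re + a 0 1) = 0 := by
            linear_combination h - hdet
          linear_combination (mul_eq_zero.1 this).resolve_left hc
      ext z
      rw [hiff]
      constructor
      · exact mem_range_halfCircle hr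
      · rintro ⟨t, rfl⟩
        exact halfCircle_eq hr t

/-- An isometry of the real line without fixed points is a translation. -/
theorem exists_translation {f : ℝ → ℝ} (hf : Isometry f) (hfix : ∀ t, f t ≠ t) :
    ∃ a, a ≠ 0 ∧ ∀ t, f t = t + a := by
  have h : ∀ s t, f s - f t = s - t ∨ f s - f t = -(s - t) := fun s t => by
    have := hf.dist_eq s t
    rw [Real.dist_eq, Real.dist_eq] at this
    exact abs_eq_abs.1 this
  -- Otherwise `f` would fix `f 0 / 2`, like the reflection `t ↦ f 0 - t`.
  have h2 : f (f 0 / 2) = f 0 / 2 + f 0 := by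
    rcases h (f 0 / 2) 0 with h | h
    · linarith
    · exact absurd (by linarith) (hfix (f 0 / 2))
  refine ⟨f 0, hfix 0, fun t => ?_⟩
  rcases h t 0 with h1 | h1
  · linarith
  · rcases h t (f 0 / 2) with h3 | h3
    · have : t = 0 := by linarith
      subst this
      simp
    · exact absurd (by linarith) (hfix 0)

/-! ### Periods from cocompactness -/

theorem hat_conj_mem {Γ : Subgroup PSL(2, ℝ)} (hΓ : Γ.map hat = Γ) {g d : PSL(2, ℝ)}
    (hg : g ∈ Γ) (hd : d ∈ Γ) : hat d * g * d⁻¹ ∈ Γ := by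
  refine mul_mem (mul_mem ?_ hg) (inv_mem hd)
  have h := Subgroup.mem_map_of_mem hat hd
  rwa [hΓ] at h

theorem isOpenQuotientMap_proj (Γ : Subgroup PSL(2, ℝ)) : IsOpenQuotientMap (proj Γ) := by
  have : ContinuousConstSMul Γ ℍ := ⟨fun g => continuous_const_smul (g : PSL(2, ℝ))⟩
  exact MulAction.isOpenQuotientMap_quotientMk

theorem proj_eq_iff (Γ : Subgroup PSL(2, ℝ)) {z w : ℍ} :
    proj Γ z = proj Γ w ↔ ∃ g ∈ Γ, g • w = z := by
  refine Quotient.eq.trans ⟨?_, ?_⟩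
  · rintro ⟨g, h⟩
    exact ⟨g, g.2, h⟩
  · rintro ⟨g, hg, h⟩
    exact ⟨⟨g, hg⟩, h⟩

theorem proj_mem_fixedPoints_iff (Γ : Subgroup PSL(2, ℝ)) (hΓ : Γ.map hat = Γ) (z : ℍ) :
    proj Γ z ∈ Function.fixedPoints (sigmaStar Γ hΓ) ↔ ∃ g ∈ Γ, z ∈ axis g :=
  proj_eq_iff Γ (z := sigma z)

theorem exists_proj_closedBall (Γ : Subgroup PSL(2, ℝ)) [CompactSpace (Surface Γ)] :
    ∃ R : ℝ, ∀ z, ∃ g ∈ Γ, g • z ∈ Metric.closedBall UpperHalfPlane.I R := by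
  have hp := isOpenQuotientMap_proj Γ
  obtain ⟨n, hn⟩ := isCompact_univ.elim_directed_cover
    (fun n : ℕ => proj Γ '' Metric.ball UpperHalfPlane.I n)
    (fun n => hp.isOpenMap _ Metric.isOpen_ball)
    (fun x _ => by
      obtain ⟨z, rfl⟩ := hp.surjective x
      obtain ⟨n, hn⟩ := exists_nat_gt (dist z UpperHalfPlane.I)
      exact Set.mem_iUnion.2 ⟨n, z, hn, rfl⟩)
    (directed_of_isDirected_le fun m n h =>
      Set.image_mono (Metric.ball_subset_ball (Nat.cast_le.2 h)))
  refine ⟨n, fun z => ?_⟩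
  obtain ⟨w, hw, h⟩ := hn (Set.mem_univ (proj Γ z))
  obtain ⟨g, hg, rfl⟩ := (proj_eq_iff Γ).1 h
  exact ⟨g, hg, Metric.ball_subset_closedBall hw⟩

theorem exists_ne_one_smul_mem_axis (Γ : Subgroup PSL(2, ℝ)) [DiscreteTopology Γ]
    [CompactSpace (Surface Γ)] (hΓ : Γ.map hat = Γ) {g : PSL(2, ℝ)} (hg : g ∈ Γ) {c : ℝ → ℍ}
    (hc : Isometry c) (hrange : axis g = Set.range c) :
    ∃ d ∈ Γ, d ≠ 1 ∧ ∀ z ∈ axis g, d • z ∈ axis g := by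
  obtain ⟨R, hR⟩ := exists_proj_closedBall Γ
  choose d hd hdR using fun n : ℕ => hR (c n)
  let T := {g : PSL(2, ℝ) | g ∈ Γ ∧ (axis g ∩ Metric.closedBall UpperHalfPlane.I R).Nonempty}
  have : Finite T := finite_axes_meeting Γ (isCompact_closedBall UpperHalfPlane.I R)
  have hcg : ∀ t, c t ∈ axis g := fun t => hrange ▸ Set.mem_range_self t
  have hT : ∀ n, hat (d n) * g * (d n)⁻¹ ∈ T := fun n =>
    ⟨hat_conj_mem hΓ hg (hd n), _, smul_mem_axis (hcg n) (d n), hdR n⟩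
  obtain ⟨⟨g', _⟩, hinf⟩ := Finite.exists_infinite_fiber fun n : ℕ =>
    (⟨hat (d n) * g * (d n)⁻¹, hT n⟩ : T)
  have hS : Set.Infinite {n : ℕ | hat (d n) * g * (d n)⁻¹ = g'} := by
    refine Set.infinite_coe_iff.1 hinf |>.mono fun n hn => ?_
    exact congrArg Subtype.val hn
  obtain ⟨m, hm⟩ := hS.nonempty
  -- Were `d n = d m` for all these `n`, the isometry `d m` would bring infinitely many `c n` into
  -- one ball, although `dist (c n) (c m) = |n - m|`.
  obtain ⟨n, hn, hne⟩ : ∃ n, hat (d n) * g * (d n)⁻¹ = g' ∧ d n ≠ d m := by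
    by_contra! hcon
    obtain ⟨N, hN⟩ := exists_nat_gt (m + (R + R))
    refine hS ((Set.finite_Iio N).subset fun n hn => ?_)
    have h1 : dist (c n) (c m) ≤ R + R := by
      rw [← dist_smul (d m)]
      refine (dist_triangle_right _ _ UpperHalfPlane.I).trans (add_le_add ?_ (hdR m))
      rw [← hcon n hn]
      exact hdR n
    rw [hc.dist_eq, Real.dist_eq] at h1
    have h2 := (le_abs_self _).trans h1
    exact Nat.cast_lt.1 (show (n : ℝ) < N by linarith)
  -- Both `d n` and `d m` carry `axis g` to `axis g'`.
  refine ⟨(d m)⁻¹ * d n, mul_mem (inv_mem (hd m)) (hd n),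
    fun h => hne (inv_mul_eq_one.1 h).symm, fun z hz => ?_⟩
  have h := smul_mem_axis (smul_mem_axis hz (d n)) (d m)⁻¹
  rw [hn, ← (show _ = g' from hm), smul_smul] at h
  convert h using 2
  simp only [map_inv]
  group

theorem exists_translation_along_axis (Γ : Subgroup PSL(2, ℝ)) [DiscreteTopology Γ]
    [CompactSpace (Surface Γ)] (htf : ∀ γ ∈ Γ, IsOfFinOrder γ → γ = 1) (hΓ : Γ.map hat = Γ)
    {g : PSL(2, ℝ)} (hg : g ∈ Γ) {c : ℝ → ℍ} (hc : Isometry c) (hrange : axis g = Set.range c) :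
    ∃ L > 0, ∃ d ∈ Γ, ∀ t, d • c t = c (t + L) := by
  obtain ⟨d, hd, hd1, hmem⟩ := exists_ne_one_smul_mem_axis Γ hΓ hg hc hrange
  have h : ∀ t, ∃ s, c s = d • c t := fun t => by
    have h := hmem (c t) (hrange ▸ Set.mem_range_self t)
    rwa [hrange] at h
  choose f hf using h
  have hfi : Isometry f := Isometry.of_dist_eq fun s t => by
    rw [← hc.dist_eq, hf, hf, dist_smul, hc.dist_eq]
  obtain ⟨a, ha, hfa⟩ := exists_translation hfi fun t ht =>
    hd1 (eq_one_of_smul_eq Γ htf hd (z := c t) (by rw [← hf, ht]))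
  rcases ha.lt_or_gt with ha | ha
  · refine ⟨-a, neg_pos.2 ha, d⁻¹, inv_mem hd, fun t => ?_⟩
    rw [inv_smul_eq_iff, ← hf, hfa, neg_add_cancel_right]
  · exact ⟨a, ha, d, hd, fun t => by rw [← hf, hfa]⟩

/-! ### Components of the fixed point set -/

theorem isClosed_proj_iUnion_axis (Γ : Subgroup PSL(2, ℝ)) [DiscreteTopology Γ]
    {A : Set PSL(2, ℝ)} (hA : A ⊆ Γ) (hinv : ∀ g ∈ A, ∀ d ∈ Γ, hat d * g * d⁻¹ ∈ A) :
    IsClosed (proj Γ '' ⋃ g : A, axis g) := by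
  rw [← (isOpenQuotientMap_proj Γ).isQuotientMap.isClosed_preimage]
  convert isClosed_iUnion_axis Γ hA using 1
  refine Set.Subset.antisymm ?_ (Set.subset_preimage_image _ _)
  rintro z ⟨w, hw, hwz⟩
  obtain ⟨⟨g, hg⟩, hwg⟩ := Set.mem_iUnion.1 hw
  obtain ⟨d, hd, rfl⟩ := (proj_eq_iff Γ).1 hwz.symm
  exact Set.mem_iUnion.2 ⟨⟨_, hinv g hg d hd⟩, smul_mem_axis hwg d⟩

theorem hat_conj_mul (g d e : PSL(2, ℝ)) :
    hat e * (hat d * g * d⁻¹) * e⁻¹ = hat (e * d) * g * (e * d)⁻¹ := by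
  rw [map_mul]
  group

theorem connectedComponentIn_fixedPoints (Γ : Subgroup PSL(2, ℝ)) [DiscreteTopology Γ]
    (htf : ∀ γ ∈ Γ, IsOfFinOrder γ → γ = 1) (hΓ : Γ.map hat = Γ) {g : PSL(2, ℝ)} (hg : g ∈ Γ)
    {z : ℍ} (hz : z ∈ axis g) :
    connectedComponentIn (Function.fixedPoints (sigmaStar Γ hΓ)) (proj Γ z) =
      proj Γ '' axis g := by
  have hx := (proj_mem_fixedPoints_iff Γ hΓ z).2 ⟨g, hg, hz⟩
  refine Set.Subset.antisymm ?_ (IsPreconnected.subset_connectedComponentIn ?_ ⟨z, hz, rfl⟩ ?_)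
  -- The twisted conjugacy class of `g` and its complement in `Γ` split the fixed set into two
  -- disjoint closed pieces; the first is the image of `axis g`.
  · let A : Set PSL(2, ℝ) := {h | ∃ d ∈ Γ, hat d * g * d⁻¹ = h}
    have hAΓ : A ⊆ Γ := by
      rintro _ ⟨d, hd, rfl⟩
      exact hat_conj_mem hΓ hg hd
    have hAinv : ∀ h ∈ A, ∀ e ∈ Γ, hat e * h * e⁻¹ ∈ A := by
      rintro _ ⟨d, hd, rfl⟩ e he
      exact ⟨e * d, mul_mem he hd, (hat_conj_mul g d e).symm⟩
    have hBinv : ∀ h ∈ (Γ : Set PSL(2, ℝ)) \ A, ∀ e ∈ Γ,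
        hat e * h * e⁻¹ ∈ (Γ : Set PSL(2, ℝ)) \ A := by
      rintro h ⟨hh, hhA⟩ e he
      refine ⟨hat_conj_mem hΓ hh he, fun hmem => hhA ?_⟩
      have := hAinv _ hmem e⁻¹ (inv_mem he)
      rw [hat_conj_mul] at this
      simpa using this
    have hAproj : proj Γ '' (⋃ h : A, axis h) = proj Γ '' axis g := by
      refine Set.Subset.antisymm ?_ (Set.image_mono fun w hw => Set.mem_iUnion.2
        ⟨⟨g, 1, one_mem Γ, by simp⟩, hw⟩)
      rintro _ ⟨w, hw, rfl⟩
      obtain ⟨⟨_, d, hd, rfl⟩, hw⟩ := Set.mem_iUnion.1 hw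
      refine ⟨d⁻¹ • w, ?_, (proj_eq_iff Γ).2 ⟨d⁻¹, inv_mem hd, rfl⟩⟩
      have := smul_mem_axis hw d⁻¹
      rw [hat_conj_mul] at this
      simpa using this
    have hdisj : Disjoint (proj Γ '' ⋃ h : A, axis h)
        (proj Γ '' ⋃ h : ((Γ : Set PSL(2, ℝ)) \ A : Set PSL(2, ℝ)), axis h) := by
      rw [Set.disjoint_left]
      rintro _ ⟨w, hw, rfl⟩ ⟨v, hv, hvw⟩
      obtain ⟨⟨h, hh⟩, hw⟩ := Set.mem_iUnion.1 hw
      obtain ⟨⟨k, hk⟩, hv⟩ := Set.mem_iUnion.1 hv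
      obtain ⟨d, hd, rfl⟩ := (proj_eq_iff Γ).1 hvw
      have hmem := hAinv h hh d hd
      rw [eq_of_mem_axis Γ htf (hAΓ hmem) hk.1 (smul_mem_axis hw d) hv] at hmem
      exact hk.2 hmem
    have hsub := connectedComponentIn_subset (Function.fixedPoints (sigmaStar Γ hΓ)) (proj Γ z)
    have hxA : proj Γ z ∈ proj Γ '' ⋃ h : A, axis h := hAproj ▸ ⟨z, hz, rfl⟩
    rw [← hAproj]
    refine (isPreconnected_iff_subset_of_disjoint_closed.1 isPreconnected_connectedComponentIn _ _
      (isClosed_proj_iUnion_axis Γ hAΓ hAinv)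
      (isClosed_proj_iUnion_axis Γ Set.sdiff_subset hBinv) (fun y hy => ?_)
      (by rw [hdisj.inter_eq, Set.inter_empty])).resolve_right fun h =>
        Set.disjoint_left.1 hdisj hxA (h (mem_connectedComponentIn hx))
    obtain ⟨w, rfl⟩ := (isOpenQuotientMap_proj Γ).surjective y
    obtain ⟨h, hh, hw⟩ := (proj_mem_fixedPoints_iff Γ hΓ w).1 (hsub hy)
    by_cases hhA : h ∈ A
    · exact Or.inl ⟨w, Set.mem_iUnion.2 ⟨⟨h, hhA⟩, hw⟩, rfl⟩
    · exact Or.inr ⟨w, Set.mem_iUnion.2 ⟨⟨h, hh, hhA⟩, hw⟩, rfl⟩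
  · obtain ⟨c, hc, hrange⟩ := axis_eq_range g ⟨z, hz⟩
    rw [hrange]
    exact (isPreconnected_range hc.continuous).image _
      (isOpenQuotientMap_proj Γ).continuous.continuousOn
  · rintro _ ⟨w, hw, rfl⟩
    exact (proj_mem_fixedPoints_iff Γ hΓ w).2 ⟨g, hg, hw⟩

end HypSurface
end

theorem theorem2p2 (Γ : Subgroup PSL(2, ℝ))
    (hdiscrete : DiscreteTopology Γ)
    (hcocompact : CompactSpace (HypSurface.Surface Γ))
    (htorsionfree : ∀ γ ∈ Γ, IsOfFinOrder γ → γ = 1)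
    (hsigma : Γ.map HypSurface.hat = Γ) :
    ∀ x ∈ Function.fixedPoints (HypSurface.sigmaStar Γ hsigma),
      HypSurface.IsClosedGeodesic Γ
        (connectedComponentIn (Function.fixedPoints (HypSurface.sigmaStar Γ hsigma)) x) := by
  intro x hx
  obtain ⟨z, rfl⟩ := (HypSurface.isOpenQuotientMap_proj Γ).surjective x
  obtain ⟨g, hg, hz⟩ := (HypSurface.proj_mem_fixedPoints_iff Γ hsigma z).1 hx
  obtain ⟨c, hc, hrange⟩ := HypSurface.axis_eq_range g ⟨z, hz⟩
  obtain ⟨L, hL, d, hd, hdc⟩ :=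
    HypSurface.exists_translation_along_axis Γ htorsionfree hsigma hg hc hrange
  refine ⟨c, L, hc, hL, fun t => ?_, ?_⟩
  · exact (HypSurface.proj_eq_iff Γ).2 ⟨d, hd, hdc t⟩
  · rw [HypSurface.connectedComponentIn_fixedPoints Γ htorsionfree hsigma hg hz, hrange,
      ← Set.range_comp]
    rfl
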